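/- Let $(F,\partial)$ be a differentially closed field of characteristic zero with commuting derivations $\partial=(\partial^1,\dots,\partial^m)^t$ that are linearly independent over $F$, and let $C$ be its field of constants. For $\delta=(\delta^1,\dots,\delta^m)^t$ let $GL^{\delta}(m,F)=\{g\in GL(m,F):\delta^i g^j_k=\delta^j g^i_k \text{ for all } i,j,k\}$ (upper index = row), and let $\mathbf B=\{g^{-1}\partial : g\in GL^{\partial}(m,F)\}$. For a differential polynomial or differential rational function (a quotient of two differential polynomials) $f$ over $C$, write $f^{\delta}$ for its evaluation with $\delta\in\mathbf B$ as the derivations; it is defined where its denominator does not vanish. For each $\delta\in\mathbf B$ let $W_\delta\subseteq F^l$ be a closed irreducible set in the $\delta$-differential Zariski topology; write $W_e=W_\partial$. Let $\tau=(\tau_1,\dots,\tau_l)$ be differential rational functions over $C$ in the components of $(h,g,\mathbf v)$, defined for all $\delta\in\mathbf B$, $(h,g)\in GL(n,F)\times GL^{\delta}(m,F)$, $\mathbf v\in W_\delta$, such that $\tau^{\delta}\langle h,g;\mathbf v\rangle\in W_{g^{-1}\delta}$, $\tau^\delta\langle I_n,I_m;\mathbf v\rangle=\mathbf v$ and $$\tau^{g^{-1}\delta}\langle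 h_1,g_1;\tau^{\delta}\langle h,g;\mathbf v\rangle\rangle=\tau^{\delta}\langle hh_1,gg_1;\mathbf v\rangle\qquad (h_1\in GL(n,F),\ g_1\in GL^{g^{-1}\delta}(m,F)).$$ Let $W_{0\delta}\subseteq W_\delta$ $(\delta\in\mathbf B)$ be dense subsets with $\tau^\delta\langle h,g;\mathbf v\rangle\in W_{0\,g^{-1}\delta}$ for $\mathbf v\in W_{0\delta}$, and let $P=(P_0,P_1)$ be a pair of matrices of differential rational functions over $C$ in $\mathbf x=(x_1,\dots,x_l)$, defined at every $\mathbf v\in W_{0\delta}$, with $P_0^\delta\langle\mathbf v\rangle\in GL(n,F)$, $P_1^\delta\langle\mathbf v\rangle\in GL^{\delta}(m,F)$ and $$P_0^{g^{-1}\delta}\langle\tau^\delta\langle h,g;\mathbf v\rangle\rangle=h^{-1}P_0^\delta\langle\mathbf v\rangle,\qquad P_1^{g^{-1}\delta}\langle\tau^\delta\langle h,g;\mathbf v\rangle\rangle=g^{-1}P_1^\delta\langle\mathbf v\rangle$$ for all $\delta\in\mathbf B$, $\mathbf v\in W_{0\delta}$, $(h,g)\in GL(n,F)\times GL^{\delta}(m,F)$.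 Let $C\langle W_e;\partial\rangle$ be the field of $\partial$-differential rational functions on $W_e$ with coefficients in $C$, that is, the fraction field of the ring of $\partial$-differential polynomials over $C$ modulo those vanishing on $W_e$, with its induced derivations $\partial$. Let $C\langle W_e;\partial\rangle^G$ be the set of its elements $f^\partial\langle\mathbf x\rangle$, where $f$ is a differential rational function over $C$ whose denominator does not vanish identically on any $W_\delta$, $\delta\in\mathbf B$, and which satisfies $f^{g^{-1}\delta}\langle\tau^\delta\langle h,g;\mathbf v\rangle\rangle=f^\delta\langle\mathbf v\rangle$ for all $\delta\in\mathbf B$, $(h,g)\in GL(n,F)\times GL^\delta(m,F)$, $\mathbf v\in W_\delta$ for which both sides are defined. Then $P_0^\partial\langle\mathbf x\rangle$ and $P_1^\partial\langle\mathbf x\rangle$ are invertible matrices over $C\langle W_e;\partial\rangle$, the derivations $\delta=P_1^{\partial}\langle\mathbf x\rangle^{-1}\partial$ of $C\langle W_e;\partial\rangle$ commute, and as a $\delta$-differential field $C\langle W_e;\partial\rangle$ is generated over $C\langle W_e;\partial\rangle^G$ by the components of $P^{\partial}\langle\mathbf x\rangle$: $$C\langle W_e;\partial\rangle=C\langle W_e;\partial\rangle^G\langle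 P^{\partial}\langle\mathbf x\rangle;\delta\rangle,$$ i.e. the smallest subfield of $C\langle W_e;\partial\rangle$ that contains $C\langle W_e;\partial\rangle^G$ and all entries of $P_0^\partial\langle\mathbf x\rangle$ and $P_1^\partial\langle\mathbf x\rangle$ and is stable under $\delta^1,\dots,\delta^m$ is $C\langle W_e;\partial\rangle$ itself. -/

import Mathlib

noncomputable section

namespace DiffInv

open scoped Topology

universe u

/-! ### Partial differential fields -/

section Basic

variable {F : Type*} [Field F] {m : ℕ}

/-- The operators `d 0, …, d (m-1)` commute pairwise. -/
def Commuting (d : Fin m → Derivation ℤ F F) : Prop :=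
  ∀ (i j : Fin m) (a : F), d i (d j a) = d j (d i a)

/-- The constant field `{a | d i a = 0 for all i}`. -/
def constants (d : Fin m → Derivation ℤ F F) : Subfield F where
  carrier := {a | ∀ i, d i a = 0}
  mul_mem' := by
    intro a b ha hb i
    simp [Derivation.leibniz, ha i, hb i]
  one_mem' := by intro i; simp
  add_mem' := by
    intro a b ha hb i
    simp [ha i, hb i]
  zero_mem' := by intro i; simp
  neg_mem' := by
    intro a ha i
    simp [ha i]
  inv_mem' := by
    intro a ha i
    simp [Derivation.leibniz_inv, ha i]

/-- The composite `(d 0)^(α 0) ∘ ⋯ ∘ (d (m-1))^(α (m-1))`; used for commuting operators only. -/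
def iterD (d : Fin m → Derivation ℤ F F) (α : Fin m → ℕ) : Module.End ℤ F :=
  ((List.finRange m).map fun i => ((d i : F →ₗ[ℤ] F) : Module.End ℤ F) ^ α i).prod

/-- The system of operators `g⁻¹ d`. -/
def twist (g : Matrix (Fin m) (Fin m) F) (d : Fin m → Derivation ℤ F F) :
    Fin m → Derivation ℤ F F :=
  fun i => ∑ j, g⁻¹ i j • d j

/-- Membership in `GL^d(m, F)`: the matrix `g`, with rows indexed by the upper index, is invertible
and `d i (g j k) = d j (g i k)`. -/
def MemGL (d : Fin m → Derivation ℤ F F) (g : Matrix (Fin m) (Fin m) F) : Prop :=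
  IsUnit g.det ∧ ∀ i j k, d i (g j k) = d j (g i k)

/-- The base of the groupoid: all `g⁻¹ d` with `g ∈ GL^d(m, F)`. -/
def base (d : Fin m → Derivation ℤ F F) : Set (Fin m → Derivation ℤ F F) :=
  {δ | ∃ g, MemGL d g ∧ δ = twist g d}

theorem mem_base_self (d : Fin m → Derivation ℤ F F) : d ∈ base d := by
  refine ⟨1, ⟨by simp, ?_⟩, ?_⟩
  · intro i j k
    by_cases h1 : j = k <;> by_cases h2 : i = k <;> simp [Matrix.one_apply, h1, h2]
  · funext i
    simp [twist, Matrix.one_apply]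

end Basic

/-! ### Differential polynomials -/

/-- Differential polynomials over `R`, with constant coefficients or with coefficients in a
differential field, in the indeterminates `x_i` (`i : ι`) and `m` commuting derivations:
the variable `(i, α)` stands for the derivative of `x_i` of multi-index `α`. -/
abbrev DiffPoly (R : Type*) [CommRing R] (m : ℕ) (ι : Type*) :=
  MvPolynomial (ι × (Fin m → ℕ)) R

/-- The value `p^d{v}` of a differential polynomial at `v`, with respect to the operators `d`. -/
def diffEval {R K ι : Type*} [CommRing R] [Field K] [Algebra R K] {m : ℕ}
    (d : Fin m → Derivation ℤ K K) (v : ι → K) : DiffPoly R m ι →ₐ[R] K :=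
  MvPolynomial.aeval fun x => iterD d x.2 (v x.1)

/-- The `i`-th derivation of the ring of differential polynomials with constant coefficients. -/
def polyDer (R : Type*) [CommRing R] (m : ℕ) (ι : Type*) (i : Fin m) :
    Derivation R (DiffPoly R m ι) (DiffPoly R m ι) :=
  MvPolynomial.mkDerivation R fun x => MvPolynomial.X (x.1, x.2 + Pi.single i 1)

/-- `(F, d)` is differentially closed: every finite system of differential polynomial equations
and an inequation over `F` that has a solution in some differential field extension (with
commuting derivations) has a solution in `F`. -/
def IsDifferentiallyClosed {F : Type u} [Field F] {m : ℕ} (d : Fin m → Derivation ℤ F F) : Prop :=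
  ∀ (E : Type u) [Field E] [Algebra F E] (e : Fin m → Derivation ℤ E E),
    Commuting e → (∀ i a, e i (algebraMap F E a) = algebraMap F E (d i a)) →
    ∀ (k : ℕ) (Sys : Finset (DiffPoly F m (Fin k))) (q : DiffPoly F m (Fin k)),
      (∃ y : Fin k → E, (∀ p ∈ Sys, diffEval e y p = 0) ∧ diffEval e y q ≠ 0) →
      ∃ y : Fin k → F, (∀ p ∈ Sys, diffEval d y p = 0) ∧ diffEval d y q ≠ 0

section Topology

variable {F : Type*} [Field F] {m : ℕ} {ι : Type*}

/-- The common zeros in `F^ι` of a set of `d`-differential polynomials over `F`. -/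
def zeroLocus (d : Fin m → Derivation ℤ F F) (S : Set (DiffPoly F m ι)) : Set (ι → F) :=
  {v | ∀ p ∈ S, diffEval d v p = 0}

/-- The `d`-differential Zariski topology on `F^ι`: the closed sets are the zero loci. -/
@[reducible]
def kolchinTopology (d : Fin m → Derivation ℤ F F) : TopologicalSpace (ι → F) :=
  TopologicalSpace.ofClosed (Set.range (zeroLocus d))
    ⟨{1}, by ext v; simp [zeroLocus]⟩
    (by
      intro A hA
      refine ⟨{p | ∃ S, zeroLocus d S ∈ A ∧ p ∈ S}, ?_⟩
      ext v
      constructor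
      · intro hv Z hZ
        obtain ⟨S, rfl⟩ := hA hZ
        exact fun p hp => hv p ⟨S, hZ, hp⟩
      · rintro hv p ⟨S, hS, hp⟩
        exact hv _ hS p hp)
    (by
      rintro _ ⟨S, rfl⟩ _ ⟨T, rfl⟩
      refine ⟨{r | ∃ p ∈ S, ∃ q ∈ T, r = p * q}, ?_⟩
      ext v
      constructor
      · intro hv
        by_contra hcon
        rw [Set.mem_union, not_or] at hcon
        obtain ⟨h1, h2⟩ := hcon
        simp only [zeroLocus, Set.mem_ofPred_eq, not_forall] at h1 h2
        obtain ⟨p, hp, hp0⟩ := h1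
        obtain ⟨q, hq, hq0⟩ := h2
        have := hv (p * q) ⟨p, hp, q, hq, rfl⟩
        rw [map_mul] at this
        exact (mul_ne_zero hp0 hq0) this
      · rintro hv _ ⟨p, hp, q, hq, rfl⟩
        rw [map_mul]
        rcases hv with hv | hv
        · rw [hv p hp, zero_mul]
        · rw [hv q hq, mul_zero])

theorem isClosed_iff (d : Fin m → Derivation ℤ F F) (Z : Set (ι → F)) :
    IsClosed[kolchinTopology d] Z ↔ ∃ S, zeroLocus d S = Z := by
  rw [← @isOpen_compl_iff _ _ (kolchinTopology d)]
  change Zᶜᶜ ∈ Set.range (zeroLocus d) ↔ _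
  rw [compl_compl]
  rfl

/-- An irreducible closed subset of `F^ι`. -/
structure IrreducibleClosed (d : Fin m → Derivation ℤ F F) (ι : Type*) where
  carrier : Set (ι → F)
  isClosed : IsClosed[kolchinTopology d] carrier
  isIrreducible : @IsIrreducible _ (kolchinTopology d) carrier

end Topology

/-- The ring homomorphism `p ↦ f p + ε f (D p)` into the dual numbers over `K`. -/
def dualHom {R A K : Type*} [CommRing R] [CommRing A] [Algebra R A] [Field K] (f : A →+* K)
    (D : Derivation R A A) : A →+* TrivSqZeroExt K K where
  toFun p := TrivSqZeroExt.inl (f p) + TrivSqZeroExt.inr (f (D p))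
  map_one' := by
    ext <;> simp
  map_mul' p q := by
    ext
    · simp
    · simp [mul_comm]
  map_zero' := by
    ext <;> simp
  map_add' p q := by
    ext <;> simp

theorem dualHom_fst {R A K : Type*} [CommRing R] [CommRing A] [Algebra R A] [Field K]
    (f : A →+* K) (D : Derivation R A A) (p : A) : (dualHom f D p).fst = f p := by
  simp [dualHom]

theorem dualHom_snd {R A K : Type*} [CommRing R] [CommRing A] [Algebra R A] [Field K]
    (f : A →+* K) (D : Derivation R A A) (p : A) : (dualHom f D p).snd = f (D p) := by
  simp [dualHom]

theorem exists_derivation_aux {Q K : Type*} [CommRing Q] [Field K] [Algebra Q K]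
    [IsFractionRing Q K] (f : Q →+* TrivSqZeroExt K K)
    (hfst : ∀ a : Q, (f a).fst = algebraMap Q K a) :
    ∃ D : Derivation ℤ K K, ∀ a : Q, D (algebraMap Q K a) = (f a).snd := by
  have hu : ∀ y : nonZeroDivisors Q, IsUnit (f y) := by
    intro y
    rw [TrivSqZeroExt.isUnit_iff_isUnit_fst, hfst]
    exact IsLocalization.map_units K y
  let g : K →+* TrivSqZeroExt K K := IsLocalization.lift hu
  have hg : ∀ a : Q, g (algebraMap Q K a) = f a := fun a => IsLocalization.lift_eq hu a
  have hgf : ∀ x, (g x).fst = x := by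
    intro x
    have h : (TrivSqZeroExt.fstHom ℤ K K).toRingHom.comp g = RingHom.id _ := by
      apply IsLocalization.ringHom_ext (nonZeroDivisors Q)
      ext1 a
      simp only [RingHom.comp_apply, hg]
      exact hfst a
    exact RingHom.congr_fun h x
  let D0 : K →+ K :=
    { toFun := fun x => (g x).snd
      map_zero' := by simp
      map_add' := by intro x y; simp }
  refine ⟨Derivation.mk' D0.toIntLinearMap ?_, ?_⟩
  · intro x y
    change (g (x * y)).snd = x • (g y).snd + y • (g x).snd
    rw [map_mul, TrivSqZeroExt.snd_mul, hgf, hgf]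
    simp [mul_comm]
  · intro a
    change (g (algebraMap Q K a)).snd = _
    rw [hg]

/-! ### The field of differential rational functions on an irreducible closed set -/

section FunctionField

variable {F : Type*} [Field F] {m : ℕ} {ι : Type*} {d : Fin m → Derivation ℤ F F}

/-- The differential polynomials with constant coefficients that vanish on `V`. -/
def vanishingIdeal (V : IrreducibleClosed d ι) : Ideal (DiffPoly (constants d) m ι) where
  carrier := {p | ∀ v ∈ V.carrier, diffEval d v p = 0}
  add_mem' := by
    intro p q hp hq v hv
    rw [map_add, hp v hv, hq v hv, add_zero]
  zero_mem' := by intro v _; simp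
  smul_mem' := by
    intro c p hp v hv
    rw [smul_eq_mul, map_mul, hp v hv, mul_zero]

theorem mem_vanishingIdeal {V : IrreducibleClosed d ι} {p : DiffPoly (constants d) m ι} :
    p ∈ vanishingIdeal V ↔ ∀ v ∈ V.carrier, diffEval d v p = 0 := Iff.rfl

theorem diffEval_map (v : ι → F) (p : DiffPoly (constants d) m ι) :
    diffEval d v (MvPolynomial.map (algebraMap (constants d) F) p) = diffEval d v p := by
  simp [diffEval, MvPolynomial.aeval_map_algebraMap]

theorem isOpen_ne_zero (p : DiffPoly (constants d) m ι) :
    IsOpen[kolchinTopology d] {v : ι → F | diffEval d v p ≠ 0} := by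
  have h : IsClosed[kolchinTopology d] {v : ι → F | diffEval d v p = 0} := by
    rw [isClosed_iff]
    refine ⟨{MvPolynomial.map (algebraMap (constants d) F) p}, ?_⟩
    ext v
    simp [zeroLocus, diffEval_map]
  exact (@isOpen_compl_iff _ _ (kolchinTopology d)).2 h

instance vanishingIdeal_isPrime (V : IrreducibleClosed d ι) : (vanishingIdeal V).IsPrime := by
  refine ⟨?_, ?_⟩
  · intro h
    obtain ⟨v, hv⟩ := @IsIrreducible.nonempty _ (kolchinTopology d) _ V.isIrreducible
    have h1 : (1 : DiffPoly (constants d) m ι) ∈ vanishingIdeal V := by rw [h]; trivial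
    simpa using h1 v hv
  · intro p q hpq
    by_contra hcon
    rw [not_or] at hcon
    obtain ⟨hp, hq⟩ := hcon
    simp only [mem_vanishingIdeal, not_forall] at hp hq
    obtain ⟨v, hv, hpv⟩ := hp
    obtain ⟨w, hw, hqw⟩ := hq
    obtain ⟨z, hz, hz1, hz2⟩ :=
      (@IsIrreducible.isPreirreducible _ (kolchinTopology d) _ V.isIrreducible) _ _
        (isOpen_ne_zero p) (isOpen_ne_zero q) ⟨v, hv, hpv⟩ ⟨w, hw, hqw⟩
    have := hpq z hz
    rw [map_mul] at this
    exact (mul_ne_zero hz1 hz2) this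

/-- The field `C⟨V; d⟩` of `d`-differential rational functions on `V` with constant coefficients:
the fraction field of the ring of differential polynomial functions on `V`. -/
def FunctionField (V : IrreducibleClosed d ι) :=
  FractionRing (DiffPoly (constants d) m ι ⧸ vanishingIdeal V)

instance (V : IrreducibleClosed d ι) : Field (FunctionField V) :=
  inferInstanceAs (Field (FractionRing (DiffPoly (constants d) m ι ⧸ vanishingIdeal V)))

instance (V : IrreducibleClosed d ι) :
    Algebra (DiffPoly (constants d) m ι ⧸ vanishingIdeal V) (FunctionField V) :=
  inferInstanceAs (Algebra (DiffPoly (constants d) m ι ⧸ vanishingIdeal V)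
    (FractionRing (DiffPoly (constants d) m ι ⧸ vanishingIdeal V)))

instance (V : IrreducibleClosed d ι) :
    IsFractionRing (DiffPoly (constants d) m ι ⧸ vanishingIdeal V) (FunctionField V) :=
  inferInstanceAs (IsFractionRing (DiffPoly (constants d) m ι ⧸ vanishingIdeal V)
    (FractionRing (DiffPoly (constants d) m ι ⧸ vanishingIdeal V)))

/-- The class in `C⟨V; d⟩` of a differential polynomial. -/
def toField (V : IrreducibleClosed d ι) : DiffPoly (constants d) m ι →+* FunctionField V :=
  (algebraMap _ (FunctionField V)).comp (Ideal.Quotient.mk (vanishingIdeal V))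

theorem iterD_list {D : Fin m → Module.End ℤ F} (hD : ∀ i j, Commute (D i) (D j))
    (α : Fin m → ℕ) (i : Fin m) (L : List (Fin m)) (hL : L.Nodup) (hi : i ∈ L) :
    (L.map fun j => D j ^ (α + Pi.single i 1 : Fin m → ℕ) j).prod =
      D i * (L.map fun j => D j ^ α j).prod := by
  induction L with
  | nil => simp at hi
  | cons a L ih =>
    rw [List.nodup_cons] at hL
    by_cases h : a = i
    · subst h
      have h2 : (L.map fun j => D j ^ (α + Pi.single a 1 : Fin m → ℕ) j) =
          L.map fun j => D j ^ α j := by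
        apply List.map_congr_left
        intro j hj
        have : j ≠ a := fun e => hL.1 (e ▸ hj)
        simp [this]
      simp only [List.map_cons, List.prod_cons, h2]
      rw [Pi.add_apply, Pi.single_eq_same, pow_succ', mul_assoc]
    · have hi' : i ∈ L := by
        rcases List.mem_cons.1 hi with h' | h'
        · exact absurd h'.symm h
        · exact h'
      simp only [List.map_cons, List.prod_cons, ih hL.2 hi']
      rw [Pi.add_apply, Pi.single_eq_of_ne h, add_zero, ← mul_assoc,
        ((hD i a).pow_right (α a)).symm.eq, mul_assoc]

theorem iterD_add_single (hd : Commuting d) (α : Fin m → ℕ) (i : Fin m) (a : F) :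
    iterD d (α + Pi.single i 1) a = d i (iterD d α a) := by
  have hD : ∀ i j, Commute ((d i : F →ₗ[ℤ] F) : Module.End ℤ F) ((d j : F →ₗ[ℤ] F)) := by
    intro i j
    ext a
    exact hd i j a
  have := iterD_list hD α i (List.finRange m) (List.nodup_finRange m) (List.mem_finRange i)
  unfold iterD
  rw [this]
  rfl

/-- Evaluation commutes with the derivations. -/
theorem diffEval_polyDer (hd : Commuting d) (i : Fin m) (v : ι → F)
    (p : DiffPoly (constants d) m ι) :
    diffEval d v (polyDer _ m ι i p) = d i (diffEval d v p) := by
  induction p using MvPolynomial.induction_on with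
  | C a =>
    have h1 : polyDer (constants d) m ι i (MvPolynomial.C a) = 0 := by
      exact Derivation.map_algebraMap _ a
    rw [h1, map_zero]
    have h2 : diffEval d v (MvPolynomial.C a) = (a : F) := by
      simp [diffEval]
      rfl
    rw [h2, a.2 i]
  | add p q hp hq => simp [hp, hq]
  | mul_X p x hp =>
    have h1 : polyDer (constants d) m ι i (MvPolynomial.X x) =
        MvPolynomial.X (x.1, x.2 + Pi.single i 1) := by
      rw [polyDer, MvPolynomial.mkDerivation_X]
    have h2 : ∀ x : ι × (Fin m → ℕ), diffEval d v
        (MvPolynomial.X x : DiffPoly (constants d) m ι) = iterD d x.2 (v x.1) := by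
      intro x
      simp [diffEval]
    rw [Derivation.leibniz, h1]
    simp only [map_add, smul_eq_mul, map_mul, h2, hp, Derivation.leibniz]
    rw [iterD_add_single hd]

theorem polyDer_mem (hd : Commuting d) (V : IrreducibleClosed d ι) (i : Fin m)
    {p : DiffPoly (constants d) m ι} (hp : p ∈ vanishingIdeal V) :
    polyDer _ m ι i p ∈ vanishingIdeal V := by
  intro v hv
  rw [diffEval_polyDer hd, hp v hv, map_zero]

theorem toField_eq_zero {V : IrreducibleClosed d ι} {p : DiffPoly (constants d) m ι} :
    toField V p = 0 ↔ p ∈ vanishingIdeal V := by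
  have h := IsLocalization.injective (FunctionField V)
    (le_refl (nonZeroDivisors (DiffPoly (constants d) m ι ⧸ vanishingIdeal V)))
  rw [toField, RingHom.comp_apply, map_eq_zero_iff _ h, Ideal.Quotient.eq_zero_iff_mem]

theorem exists_derivation (hd : Commuting d) (V : IrreducibleClosed d ι) (i : Fin m) :
    ∃ D : Derivation ℤ (FunctionField V) (FunctionField V),
      ∀ p, D (toField V p) = toField V (polyDer _ m ι i p) := by
  obtain ⟨D, hD⟩ := exists_derivation_aux (K := FunctionField V)
    (Ideal.Quotient.lift (vanishingIdeal V) (dualHom (toField V) (polyDer (constants d) m ι i)) (by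
      intro p hp
      have h1 := toField_eq_zero.2 hp
      have h2 := toField_eq_zero.2 (polyDer_mem hd V i hp)
      exact TrivSqZeroExt.ext ((dualHom_fst _ _ _).trans h1) ((dualHom_snd _ _ _).trans h2)))
    (by
      intro a
      obtain ⟨p, rfl⟩ := Ideal.Quotient.mk_surjective a
      rw [Ideal.Quotient.lift_mk, dualHom_fst]
      rfl)
  refine ⟨D, fun p => ?_⟩
  refine (hD (Ideal.Quotient.mk _ p)).trans ?_
  rw [Ideal.Quotient.lift_mk, dualHom_snd]

/-- The derivations of `C⟨V; d⟩`: the extensions of the derivations of the differential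
polynomials (a derivation of an integral domain extends to its fraction field uniquely). -/
def fieldDer (hd : Commuting d) (V : IrreducibleClosed d ι) (i : Fin m) :
    Derivation ℤ (FunctionField V) (FunctionField V) :=
  (exists_derivation hd V i).choose

theorem fieldDer_toField (hd : Commuting d) (V : IrreducibleClosed d ι) (i : Fin m)
    (p : DiffPoly (constants d) m ι) :
    fieldDer hd V i (toField V p) = toField V (polyDer _ m ι i p) :=
  (exists_derivation hd V i).choose_spec p

end FunctionField

/-! ### Differential rational functions -/

/-- A differential rational expression: a quotient of two differential polynomials. Its
coefficients do not depend on the operators with respect to which it is evaluated. -/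
structure DiffRat (R : Type*) [CommRing R] (m : ℕ) (ι : Type*) where
  num : DiffPoly R m ι
  den : DiffPoly R m ι

namespace DiffRat

variable {R K ι : Type*} [CommRing R] [Field K] [Algebra R K] {m : ℕ}

/-- The denominator of `f^δ` does not vanish at `v`. -/
def DefinedAt (f : DiffRat R m ι) (δ : Fin m → Derivation ℤ K K) (v : ι → K) : Prop :=
  diffEval δ v f.den ≠ 0

/-- The value `f^δ⟨v⟩`, meaningful where `f^δ` is defined at `v`. -/
def eval (f : DiffRat R m ι) (δ : Fin m → Derivation ℤ K K) (v : ι → K) : K :=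
  diffEval δ v f.num / diffEval δ v f.den

/-- The element `f^d⟨x⟩` of the field `C⟨V; d⟩`, meaningful if the denominator of `f` does not
vanish identically on `V`. -/
def toField {F : Type*} [Field F] {d : Fin m → Derivation ℤ F F} (V : IrreducibleClosed d ι)
    (f : DiffRat (constants d) m ι) : FunctionField V :=
  DiffInv.toField V f.num / DiffInv.toField V f.den

end DiffRat

/-! ### Algebraic representations of the groupoid and equivariant maps -/

section Action

variable {F : Type*} [Field F] {m : ℕ}

/-- Index type for the components of a triple `(h, g, v)`: the entries of an `n × n` matrix `h`,
the entries of an `m × m` matrix `g`, and the `l` components of `v`. -/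
abbrev TripleIndex (n m l : ℕ) := (Fin n × Fin n) ⊕ (Fin m × Fin m) ⊕ Fin l

/-- The list of components of `(h, g, v)`. -/
def triple {n l : ℕ} (h : Matrix (Fin n) (Fin n) F) (g : Matrix (Fin m) (Fin m) F)
    (v : Fin l → F) : TripleIndex n m l → F :=
  Sum.elim (fun a => h a.1 a.2) (Sum.elim (fun a => g a.1 a.2) v)

/-- The value `τ^δ⟨h, g; v⟩`. -/
def act {R : Type*} [CommRing R] [Algebra R F] {n l : ℕ}
    (τ : Fin l → DiffRat R m (TripleIndex n m l)) (δ : Fin m → Derivation ℤ F F)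
    (h : Matrix (Fin n) (Fin n) F) (g : Matrix (Fin m) (Fin m) F) (v : Fin l → F) : Fin l → F :=
  fun i => (τ i).eval δ (triple h g v)

/-- The value at `v`, with respect to `δ`, of a matrix of differential rational functions. -/
def evalMatrix {R : Type*} [CommRing R] [Algebra R F] {k l : ℕ}
    (P : Matrix (Fin k) (Fin k) (DiffRat R m (Fin l))) (δ : Fin m → Derivation ℤ F F)
    (v : Fin l → F) : Matrix (Fin k) (Fin k) F :=
  fun i j => (P i j).eval δ v

/-- An algebraic (anti)representation of the groupoid with base `base d` and fibres
`GL(n, F) × GL^δ(m, F)` on a bundle `W = ⋃ (δ, W δ)`, `W δ ⊆ F^l`, whose fibres are closed and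
irreducible. The components of `τ` are differential rational functions in `h, g, v` with constant
coefficients, defined on all of `GL(n, F) × GL^δ(m, F) × W δ`. -/
structure AlgebraicAction (d : Fin m → Derivation ℤ F F) (n l : ℕ) where
  W : (Fin m → Derivation ℤ F F) → Set (Fin l → F)
  isClosed_W : ∀ δ ∈ base d, IsClosed[kolchinTopology δ] (W δ)
  isIrreducible_W : ∀ δ ∈ base d, @IsIrreducible _ (kolchinTopology δ) (W δ)
  τ : Fin l → DiffRat (constants d) m (TripleIndex n m l)
  definedAt_τ : ∀ δ ∈ base d, ∀ (h : Matrix (Fin n) (Fin n) F) (g : Matrix (Fin m) (Fin m) F),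
    IsUnit h.det → MemGL δ g → ∀ v ∈ W δ, ∀ i, (τ i).DefinedAt δ (triple h g v)
  act_mem : ∀ δ ∈ base d, ∀ (h : Matrix (Fin n) (Fin n) F) (g : Matrix (Fin m) (Fin m) F),
    IsUnit h.det → MemGL δ g → ∀ v ∈ W δ, act τ δ h g v ∈ W (twist g δ)
  act_one : ∀ δ ∈ base d, ∀ v ∈ W δ, act τ δ 1 1 v = v
  act_act : ∀ δ ∈ base d, ∀ (h h₁ : Matrix (Fin n) (Fin n) F) (g g₁ : Matrix (Fin m) (Fin m) F),
    IsUnit h.det → IsUnit h₁.det → MemGL δ g → MemGL (twist g δ) g₁ → ∀ v ∈ W δ,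
      act τ (twist g δ) h₁ g₁ (act τ δ h g v) = act τ δ (h * h₁) (g * g₁) v

/-- A map `P = (P₀, P₁) : W₀ → G`, `P^δ⟨v⟩ ∈ GL(n, F) × GL^δ(m, F)`, defined on an invariant
fibrewise dense subset `W₀` of `W`, whose components are differential rational functions with
constant coefficients, and with `P^(g⁻¹δ)⟨τ^δ⟨h, g; v⟩⟩ = (h⁻¹, g⁻¹) P^δ⟨v⟩`. -/
structure EquivariantMap {d : Fin m → Derivation ℤ F F} {n l : ℕ} (T : AlgebraicAction d n l) where
  W₀ : (Fin m → Derivation ℤ F F) → Set (Fin l → F)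
  subset_W : ∀ δ ∈ base d, W₀ δ ⊆ T.W δ
  dense_W₀ : ∀ δ ∈ base d, T.W δ ⊆ @closure _ (kolchinTopology δ) (W₀ δ)
  act_mem : ∀ δ ∈ base d, ∀ (h : Matrix (Fin n) (Fin n) F) (g : Matrix (Fin m) (Fin m) F),
    IsUnit h.det → MemGL δ g → ∀ v ∈ W₀ δ, act T.τ δ h g v ∈ W₀ (twist g δ)
  P₀ : Matrix (Fin n) (Fin n) (DiffRat (constants d) m (Fin l))
  P₁ : Matrix (Fin m) (Fin m) (DiffRat (constants d) m (Fin l))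
  definedAt_P₀ : ∀ δ ∈ base d, ∀ v ∈ W₀ δ, ∀ i j, (P₀ i j).DefinedAt δ v
  definedAt_P₁ : ∀ δ ∈ base d, ∀ v ∈ W₀ δ, ∀ i j, (P₁ i j).DefinedAt δ v
  isUnit_P₀ : ∀ δ ∈ base d, ∀ v ∈ W₀ δ, IsUnit (evalMatrix P₀ δ v).det
  memGL_P₁ : ∀ δ ∈ base d, ∀ v ∈ W₀ δ, MemGL δ (evalMatrix P₁ δ v)
  equivariant_P₀ : ∀ δ ∈ base d, ∀ (h : Matrix (Fin n) (Fin n) F) (g : Matrix (Fin m) (Fin m) F),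
    IsUnit h.det → MemGL δ g → ∀ v ∈ W₀ δ,
      evalMatrix P₀ (twist g δ) (act T.τ δ h g v) = h⁻¹ * evalMatrix P₀ δ v
  equivariant_P₁ : ∀ δ ∈ base d, ∀ (h : Matrix (Fin n) (Fin n) F) (g : Matrix (Fin m) (Fin m) F),
    IsUnit h.det → MemGL δ g → ∀ v ∈ W₀ δ,
      evalMatrix P₁ (twist g δ) (act T.τ δ h g v) = g⁻¹ * evalMatrix P₁ δ v

variable {d : Fin m → Derivation ℤ F F} {n l : ℕ}

/-- The fibre `W_e` of `W` over `d`. -/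
def AlgebraicAction.We (T : AlgebraicAction d n l) : IrreducibleClosed d (Fin l) where
  carrier := T.W d
  isClosed := T.isClosed_W d (mem_base_self d)
  isIrreducible := T.isIrreducible_W d (mem_base_self d)

/-- `f = (f^δ)` is a differential rational function on `W` with constant coefficients: its
denominator does not vanish identically on any fibre of `W`. -/
def AlgebraicAction.IsRational (T : AlgebraicAction d n l)
    (f : DiffRat (constants d) m (Fin l)) : Prop :=
  ∀ δ ∈ base d, ∃ v ∈ T.W δ, f.DefinedAt δ v

/-- `f^(g⁻¹δ)⟨τ^δ⟨h, g; v⟩⟩ = f^δ⟨v⟩` wherever both sides are defined. -/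
def AlgebraicAction.IsInvariant (T : AlgebraicAction d n l)
    (f : DiffRat (constants d) m (Fin l)) : Prop :=
  ∀ δ ∈ base d, ∀ (h : Matrix (Fin n) (Fin n) F) (g : Matrix (Fin m) (Fin m) F),
    IsUnit h.det → MemGL δ g → ∀ v ∈ T.W δ,
      f.DefinedAt δ v → f.DefinedAt (twist g δ) (act T.τ δ h g v) →
        f.eval (twist g δ) (act T.τ δ h g v) = f.eval δ v

/-- The field `C⟨W_e; d⟩^G` of invariant differential rational functions, as a subset of
`C⟨W_e; d⟩`: the fibres over `d` of the invariant differential rational functions on `W`. -/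
def AlgebraicAction.invariants (T : AlgebraicAction d n l) : Set (FunctionField T.We) :=
  {x | ∃ f : DiffRat (constants d) m (Fin l),
    T.IsRational f ∧ T.IsInvariant f ∧ f.toField T.We = x}

variable {T : AlgebraicAction d n l}

/-- The matrix `P₀^d⟨x⟩` over `C⟨W_e; d⟩`. -/
def EquivariantMap.genericP₀ (P : EquivariantMap T) :
    Matrix (Fin n) (Fin n) (FunctionField T.We) :=
  fun i j => (P.P₀ i j).toField T.We

/-- The matrix `P₁^d⟨x⟩` over `C⟨W_e; d⟩`. -/
def EquivariantMap.genericP₁ (P : EquivariantMap T) :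
    Matrix (Fin m) (Fin m) (FunctionField T.We) :=
  fun i j => (P.P₁ i j).toField T.We

/-- The set of components of `P^d⟨x⟩ = (P₀^d⟨x⟩, P₁^d⟨x⟩)`. -/
def EquivariantMap.components (P : EquivariantMap T) : Set (FunctionField T.We) :=
  {x | ∃ i j, x = P.genericP₀ i j} ∪ {x | ∃ i j, x = P.genericP₁ i j}

/-- The operators `P₁^d⟨x⟩⁻¹ d` on `C⟨W_e; d⟩`. -/
def EquivariantMap.delta (P : EquivariantMap T) (hd : Commuting d) :
    Fin m → Derivation ℤ (FunctionField T.We) (FunctionField T.We) :=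
  twist P.genericP₁ (fieldDer hd T.We)

end Action

/-- The smallest subfield of `K` that contains `S` and is stable under the operators `δ`. -/
def diffAdjoin {K : Type*} [Field K] {m : ℕ} (δ : Fin m → Derivation ℤ K K) (S : Set K) :
    Subfield K :=
  sInf {L | S ⊆ L ∧ ∀ i, ∀ a ∈ L, δ i a ∈ L}

end DiffInv

end

noncomputable section

namespace DiffInv

open scoped Topology

/-! ### The groupoid of twisted derivations -/

section Twist

variable {F : Type*} [Field F] {m : ℕ} {d : Fin m → Derivation ℤ F F}
  {g g₁ : Matrix (Fin m) (Fin m) F}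

/-! On `W₀` the map `P` is a moving frame. Moving each point `v` by its own frame gives the normal
form `w = τ^∂⟨P^∂⟨v⟩; v⟩`. If `v` is moved by `(h, g)`, its frame becomes `(h, g)⁻¹ P⟨v⟩`, so the
action law returns the same `w` (`normalForm_act`). Hence the components of `w` are invariant.
Conversely, `v = τ^δ⟨P⟨v⟩⁻¹; w⟩` with `δ = P₁⁻¹ ∂` (`act_inv_normalForm`), so the coordinates are
differential rational expressions in the invariants and the entries of `P`. Let `L` be the `δ`-field
generated by the invariants and these entries. Since `∂ = P₁ δ`, `L` is also `∂`-stable. As it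
contains the constants and the coordinates, it is everything.

These identities hold at points, whereas the claim concerns the function field. The bridge is
`fracSubring P.classValues`: pairs of a field element and a function on `W₀` given by one fraction
with nowhere vanishing denominator. The ring is stable under the derivations and under inverting
nowhere zero functions. By density the function determines the field element (`fst_eq_of_snd_eq`),
so pointwise computations lift.

Invariance also concerns all `δ` in the base at once. The coefficients are killed by every such `δ`,
so formal differentiation is independent of `δ` and the normal form is a single expression valid on
all fibres. -/

theorem twist_apply (g : Matrix (Fin m) (Fin m) F) (d : Fin m → Derivation ℤ F F) (i : Fin m)
    (a : F) : twist g d i a = ∑ j, g⁻¹ i j * d j a := by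
  have h : ∀ s : Finset (Fin m), (∑ j ∈ s, g⁻¹ i j • d j) a = ∑ j ∈ s, g⁻¹ i j * d j a := by
    intro s
    induction s using Finset.induction_on with
    | empty => simp
    | insert j s hj ih =>
      rw [Finset.sum_insert hj, Finset.sum_insert hj, Derivation.add_apply, ih]
      rfl
  exact h _

theorem apply_eq_sum_twist (hg : IsUnit g.det) (i : Fin m) (a : F) :
    d i a = ∑ j, g i j * twist g d j a := by
  have h : g.mulVec (g⁻¹.mulVec fun j => d j a) = fun j => d j a := by
    rw [Matrix.mulVec_mulVec, Matrix.mul_nonsing_inv _ hg, Matrix.one_mulVec]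
  have h' := congrFun h i
  simp only [Matrix.mulVec, dotProduct] at h'
  rw [← h']
  simp only [twist_apply]

theorem twist_twist (g g₁ : Matrix (Fin m) (Fin m) F) :
    twist g₁ (twist g d) = twist (g * g₁) d := by
  funext i
  ext a
  simp only [twist_apply, Matrix.mul_inv_rev, Matrix.mul_apply, Finset.mul_sum, Finset.sum_mul]
  rw [Finset.sum_comm]
  simp only [mul_assoc]

/-- Write `d i = ∑ k, g i k • δ k` with `δ = twist g d`. In `d i (d j a) - d j (d i a)` the
first-order terms cancel by the symmetry in `MemGL`. What remains is `g K gᵀ = 0`, where `K` is the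
matrix of commutators of the `δ k` applied to `a`, and `g` is invertible. -/
theorem commuting_twist (hd : Commuting d) (hg : MemGL d g) : Commuting (twist g d) := by
  obtain ⟨hu, hs⟩ := hg
  have key : ∀ a, g * (Matrix.of fun k l => twist g d k (twist g d l a) -
      twist g d l (twist g d k a)) * g.transpose = 0 := by
    intro a
    ext i j
    have expand : ∀ i j, d i (d j a) = ∑ l, d i (g j l) * twist g d l a +
        ∑ l, ∑ k, g j l * (g i k * twist g d k (twist g d l a)) := by
      intro i j
      rw [apply_eq_sum_twist hu j a, map_sum, ← Finset.sum_add_distrib]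
      refine Finset.sum_congr rfl fun l _ => ?_
      rw [Derivation.leibniz, apply_eq_sum_twist hu i (twist g d l a), ← Finset.mul_sum]
      simp only [smul_eq_mul]
      ring
    have h := hd i j a
    rw [expand i j, expand j i] at h
    simp only [hs i j] at h
    have h' := add_left_cancel h
    rw [Finset.sum_comm] at h'
    simp only [Matrix.mul_apply, Matrix.of_apply, Matrix.transpose_apply, Matrix.zero_apply,
      Finset.sum_mul]
    have e : ∀ l k, g i k * (twist g d k (twist g d l a) -
        twist g d l (twist g d k a)) * g j l =
        g j l * (g i k * twist g d k (twist g d l a)) -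
        g i k * (g j l * twist g d l (twist g d k a)) := by
      intro l k
      ring
    simp only [e, Finset.sum_sub_distrib]
    rw [sub_eq_zero, Finset.sum_comm, h']
    rw [Finset.sum_comm]
  intro i j a
  have h := key a
  have hut : IsUnit g.transpose.det := by rwa [Matrix.det_transpose]
  have h0 : (Matrix.of fun k l => twist g d k (twist g d l a) -
      twist g d l (twist g d k a)) = 0 := by
    have h1 := congrArg (fun M => g⁻¹ * M * g.transpose⁻¹) h
    simp only [Matrix.mul_zero, Matrix.zero_mul] at h1
    rw [← h1, Matrix.mul_assoc, Matrix.mul_nonsing_inv_cancel_right _ _ hut,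
      Matrix.nonsing_inv_mul_cancel_left _ _ hu]
  have h2 := congrFun (congrFun h0 i) j
  simpa [sub_eq_zero] using h2

/-- By the product rule, `d i` of an entry has one sum that is symmetric by `hg`, and one that
becomes symmetric by `hg₁` once `d i` is written through the twisted operators. -/
theorem MemGL.mul (hg : MemGL d g) (hg₁ : MemGL (twist g d) g₁) : MemGL d (g * g₁) := by
  refine ⟨by rw [Matrix.det_mul]; exact hg.1.mul hg₁.1, fun i j k => ?_⟩
  have expand : ∀ i j, d i ((g * g₁) j k) = ∑ l, d i (g j l) * g₁ l k +
      ∑ l, ∑ s, g j l * (g i s * twist g d s (g₁ l k)) := by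
    intro i j
    rw [Matrix.mul_apply, map_sum, ← Finset.sum_add_distrib]
    refine Finset.sum_congr rfl fun l _ => ?_
    rw [Derivation.leibniz, apply_eq_sum_twist hg.1 i (g₁ l k), ← Finset.mul_sum]
    simp only [smul_eq_mul]
    ring
  rw [expand i j, expand j i]
  simp only [hg.2 i j]
  congr 1
  rw [Finset.sum_comm]
  refine Finset.sum_congr rfl fun s _ => Finset.sum_congr rfl fun l _ => ?_
  rw [hg₁.2 s l k]
  ring

/-- Differentiate `g * g⁻¹ = 1` and solve for the derivative of the inverse. -/
theorem derivation_inv_apply (D : Derivation ℤ F F) (hg : IsUnit g.det) (j k : Fin m) :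
    D (g⁻¹ j k) = -∑ a, ∑ b, g⁻¹ j a * D (g a b) * g⁻¹ b k := by
  have h : ∀ a, ∑ b, (D (g a b) * g⁻¹ b k + g a b * D (g⁻¹ b k)) = 0 := by
    intro a
    have h1 := congrArg D (congrFun (congrFun (Matrix.mul_nonsing_inv g hg) a) k)
    rw [Matrix.mul_apply, map_sum] at h1
    have h2 : D ((1 : Matrix (Fin m) (Fin m) F) a k) = 0 := by
      by_cases e : a = k <;> simp [Matrix.one_apply, e]
    rw [h2] at h1
    rw [← h1]
    refine Finset.sum_congr rfl fun b _ => ?_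
    rw [Derivation.leibniz]
    simp only [smul_eq_mul]
    ring
  have h3 : g.mulVec (fun b => D (g⁻¹ b k)) = fun a => -∑ b, D (g a b) * g⁻¹ b k := by
    funext a
    have := h a
    rw [Finset.sum_add_distrib] at this
    exact eq_neg_of_add_eq_zero_right this
  have h4 := congrFun (congrArg (g⁻¹.mulVec) h3) j
  rw [Matrix.mulVec_mulVec, Matrix.nonsing_inv_mul _ hg, Matrix.one_mulVec] at h4
  rw [h4]
  simp only [Matrix.mulVec, dotProduct, mul_neg, Finset.sum_neg_distrib, Finset.mul_sum, mul_assoc]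

theorem MemGL.inv (hg : MemGL d g) : MemGL (twist g d) g⁻¹ := by
  refine ⟨Matrix.isUnit_nonsing_inv_det g hg.1, fun i j k => ?_⟩
  rw [derivation_inv_apply _ hg.1, derivation_inv_apply _ hg.1]
  congr 1
  simp only [twist_apply, Finset.mul_sum, Finset.sum_mul]
  have e : ∀ i j, ∑ a, ∑ b, ∑ s, g⁻¹ j a * (g⁻¹ i s * d s (g a b)) * g⁻¹ b k =
      ∑ a, ∑ s, ∑ b, g⁻¹ j a * (g⁻¹ i s * d s (g a b)) * g⁻¹ b k :=
    fun i j => Finset.sum_congr rfl fun a _ => Finset.sum_comm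
  rw [e i j, e j i, Finset.sum_comm]
  refine Finset.sum_congr rfl fun s _ => Finset.sum_congr rfl fun a _ =>
    Finset.sum_congr rfl fun b _ => ?_
  rw [hg.2 s a b]
  ring

theorem twist_mem_base {δ : Fin m → Derivation ℤ F F} (hδ : δ ∈ base d) (hg : MemGL δ g) :
    twist g δ ∈ base d := by
  obtain ⟨g₀, hg₀, rfl⟩ := hδ
  exact ⟨g₀ * g, hg₀.mul hg, twist_twist _ _⟩

theorem Commuting.of_mem_base (hd : Commuting d) {δ : Fin m → Derivation ℤ F F}
    (hδ : δ ∈ base d) : Commuting δ := by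
  obtain ⟨g₀, hg₀, rfl⟩ := hδ
  exact commuting_twist hd hg₀

theorem apply_constant {δ : Fin m → Derivation ℤ F F} (hδ : δ ∈ base d) (i : Fin m)
    (c : constants d) : δ i (c : F) = 0 := by
  obtain ⟨g₀, -, rfl⟩ := hδ
  rw [twist_apply]
  exact Finset.sum_eq_zero fun j _ => by rw [c.2 j, mul_zero]

end Twist

/-! ### Evaluation of differential polynomials -/

section Eval

variable {F R ι : Type*} [Field F] [CommRing R] [Algebra R F] {m : ℕ}
  {δ : Fin m → Derivation ℤ F F}

theorem diffEval_C (v : ι → F) (c : R) :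
    diffEval δ v (MvPolynomial.C c : DiffPoly R m ι) = algebraMap R F c := by
  simp [diffEval]

theorem diffEval_X (v : ι → F) (x : ι × (Fin m → ℕ)) :
    diffEval δ v (MvPolynomial.X x : DiffPoly R m ι) = iterD δ x.2 (v x.1) := by
  simp [diffEval]

theorem iterD_zero (a : F) : iterD δ 0 a = a := by
  simp [iterD]

/-- The polynomial `polyDer R m ι i p` does not involve `δ`, so it represents the derivative for all
operators of the base simultaneously. -/
theorem diffEval_polyDer_of_constants (hδ : Commuting δ)
    (h0 : ∀ i (c : R), δ i (algebraMap R F c) = 0) (i : Fin m) (v : ι → F) (p : DiffPoly R m ι) :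
    diffEval δ v (polyDer R m ι i p) = δ i (diffEval δ v p) := by
  induction p using MvPolynomial.induction_on with
  | C a =>
    have h1 : polyDer R m ι i (MvPolynomial.C a) = 0 := Derivation.map_algebraMap _ a
    rw [h1, map_zero, diffEval_C, h0]
  | add p q hp hq => simp [hp, hq]
  | mul_X p x hp =>
    have h1 : polyDer R m ι i (MvPolynomial.X x) = MvPolynomial.X (x.1, x.2 + Pi.single i 1) := by
      rw [polyDer, MvPolynomial.mkDerivation_X]
    rw [Derivation.leibniz, h1]
    simp only [map_add, smul_eq_mul, map_mul, diffEval_X, hp, Derivation.leibniz]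
    rw [iterD_add_single hδ]

/-- Coefficients in `F` have to be differentiated as well, so here the polynomial `p'` depends on
`δ`. -/
theorem exists_diffEval_eq_derivation (hδ : Commuting δ) (i : Fin m) (p : DiffPoly F m ι) :
    ∃ p' : DiffPoly F m ι, ∀ v, diffEval δ v p' = δ i (diffEval δ v p) := by
  induction p using MvPolynomial.induction_on with
  | C a => exact ⟨MvPolynomial.C (δ i a), fun v => by simp⟩
  | add p q hp hq =>
    obtain ⟨p', hp'⟩ := hp
    obtain ⟨q', hq'⟩ := hq
    exact ⟨p' + q', fun v => by simp [hp', hq']⟩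
  | mul_X p x hp =>
    obtain ⟨p', hp'⟩ := hp
    refine ⟨p * MvPolynomial.X (x.1, x.2 + Pi.single i 1) + MvPolynomial.X x * p', fun v => ?_⟩
    simp only [map_add, smul_eq_mul, map_mul, diffEval_X, hp', Derivation.leibniz]
    rw [iterD_add_single hδ]

/-- A differential polynomial that vanishes on a dense subset vanishes identically. -/
theorem diffEval_eq_zero_of_dense {W W₀ : Set (ι → F)}
    (hW : W ⊆ @closure _ (kolchinTopology δ) W₀) (p : DiffPoly F m ι)
    (hp : ∀ v ∈ W₀, diffEval δ v p = 0) : ∀ v ∈ W, diffEval δ v p = 0 := by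
  intro v hv
  have hc : IsClosed[kolchinTopology δ] (zeroLocus δ {p}) := (isClosed_iff _ _).2 ⟨_, rfl⟩
  have h0 : W₀ ⊆ zeroLocus δ {p} := by
    intro v hv q hq
    rw [Set.mem_singleton_iff.1 hq]
    exact hp v hv
  let _ := kolchinTopology (ι := ι) δ
  exact closure_minimal h0 hc (hW hv) p rfl

/-- Differential polynomials preserve a ring of functions that is stable under differentiation. -/
theorem diffEval_mem {X : Type*} (A : Subring (X → F)) (D : X → Fin m → Derivation ℤ F F)
    (hC : ∀ c : R, (fun _ => algebraMap R F c) ∈ A)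
    (hD : ∀ i, ∀ φ ∈ A, (fun x => D x i (φ x)) ∈ A) {u : X → ι → F}
    (hu : ∀ j, (fun x => u x j) ∈ A) (p : DiffPoly R m ι) :
    (fun x => diffEval (D x) (u x) p) ∈ A := by
  induction p using MvPolynomial.induction_on with
  | C a => simpa only [diffEval_C] using hC a
  | add p q hp hq =>
    simp only [map_add]
    exact A.add_mem hp hq
  | mul_X p y hp =>
    simp only [map_mul, diffEval_X]
    refine A.mul_mem hp ?_
    have hpow : ∀ (i : Fin m) (k : ℕ), ∀ φ ∈ A, (fun x =>
        (((D x i : F →ₗ[ℤ] F) : Module.End ℤ F) ^ k) (φ x)) ∈ A := by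
      intro i k
      induction k with
      | zero => intro φ hφ; simpa using hφ
      | succ k ih =>
        intro φ hφ
        simp only [pow_succ]
        exact ih _ (hD i φ hφ)
    have hlist : ∀ L : List (Fin m), ∀ φ ∈ A, (fun x => (L.map fun i =>
        ((D x i : F →ₗ[ℤ] F) : Module.End ℤ F) ^ y.2 i).prod (φ x)) ∈ A := by
      intro L
      induction L with
      | nil => intro φ hφ; simpa using hφ
      | cons a L ih =>
        intro φ hφ
        simp only [List.map_cons, List.prod_cons]
        exact hpow a _ _ (ih φ hφ)
    exact hlist _ _ (hu y.1)

end Eval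

/-! ### Fractions inside a ring -/

section Fractions

variable {B A : Type*} [CommRing B] [CommRing A]

/-- The elements `θ p / θ q` of `A` with `θ q` invertible. -/
def fracSubring (θ : B →+* A) : Subring A where
  carrier := {a | ∃ p q, IsUnit (θ q) ∧ θ q * a = θ p}
  mul_mem' := by
    rintro a b ⟨p, q, hq, h⟩ ⟨p', q', hq', h'⟩
    refine ⟨p * p', q * q', by rw [map_mul]; exact hq.mul hq', ?_⟩
    rw [map_mul, map_mul, ← h, ← h']
    ring
  one_mem' := ⟨1, 1, by simp, by simp⟩
  add_mem' := by
    rintro a b ⟨p, q, hq, h⟩ ⟨p', q', hq', h'⟩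
    refine ⟨p * q' + q * p', q * q', by rw [map_mul]; exact hq.mul hq', ?_⟩
    rw [map_add, map_mul, map_mul, map_mul, ← h, ← h']
    ring
  zero_mem' := ⟨0, 1, by simp, by simp⟩
  neg_mem' := by
    rintro a ⟨p, q, hq, h⟩
    exact ⟨-p, q, hq, by rw [map_neg, ← h]; ring⟩

variable {θ : B →+* A}

theorem map_mem_fracSubring (b : B) : θ b ∈ fracSubring θ := ⟨b, 1, by simp, by simp⟩

theorem mem_fracSubring_of_mul_eq_one {a b : A} (ha : a ∈ fracSubring θ) (hab : a * b = 1) :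
    b ∈ fracSubring θ := by
  obtain ⟨p, q, hq, h⟩ := ha
  have hu : IsUnit a := IsUnit.of_mul_eq_one b hab
  refine ⟨q, p, by rw [← h]; exact hq.mul hu, ?_⟩
  rw [← h, mul_assoc, hab, mul_one]

/-- The quotient rule, with denominator `q * q`. -/
theorem derivation_mem_fracSubring (Δ : Derivation ℤ A A) (hΔ : ∀ b, ∃ b', θ b' = Δ (θ b)) {a : A}
    (ha : a ∈ fracSubring θ) : Δ a ∈ fracSubring θ := by
  obtain ⟨p, q, hq, h⟩ := ha
  obtain ⟨p', hp'⟩ := hΔ p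
  obtain ⟨q', hq'⟩ := hΔ q
  refine ⟨q * p' - p * q', q * q, by rw [map_mul]; exact hq.mul hq, ?_⟩
  rw [map_sub, map_mul, map_mul, map_mul, hp', hq', ← h, Derivation.leibniz]
  simp only [smul_eq_mul]
  ring

end Fractions

/-- The derivation of a product of rings with given components. -/
def piDerivation {X : Type*} {A : X → Type*} [∀ x, CommRing (A x)]
    (D : ∀ x, Derivation ℤ (A x) (A x)) : Derivation ℤ (∀ x, A x) (∀ x, A x) :=
  Derivation.mk' (LinearMap.pi fun x => (D x : A x →ₗ[ℤ] A x) ∘ₗ LinearMap.proj x) (by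
    intro a b
    funext x
    simp)

/-- The derivation of a product of two rings with given components. -/
def prodDerivation {A B : Type*} [CommRing A] [CommRing B] (D : Derivation ℤ A A)
    (E : Derivation ℤ B B) : Derivation ℤ (A × B) (A × B) :=
  Derivation.mk' ((D : A →ₗ[ℤ] A).prodMap (E : B →ₗ[ℤ] B)) (by
    intro a b
    ext <;> simp)

/-- A ring of functions that is closed under inversion contains the entries of the inverse of a
pointwise invertible matrix. -/
theorem inv_apply_mem {X F k : Type*} [Field F] [Fintype k] [DecidableEq k] (A : Subring (X → F))
    (hA : ∀ φ ∈ A, (∀ x, φ x ≠ 0) → (fun x => (φ x)⁻¹) ∈ A) {M : X → Matrix k k F}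
    (hM : ∀ i j, (fun x => M x i j) ∈ A) (hu : ∀ x, IsUnit (M x).det) (i j : k) :
    (fun x => (M x)⁻¹ i j) ∈ A := by
  -- Cramer's rule over `A`: the adjugate and the determinant of `M'` lie in `A`, and the
  -- determinant is nowhere zero.
  let M' : Matrix k k A := fun i j => ⟨fun x => M x i j, hM i j⟩
  let e : X → A →+* F := fun x => (Pi.evalRingHom _ x).comp A.subtype
  have he : ∀ x, (e x).mapMatrix M' = M x := fun x => rfl
  have hdet : ∀ x, (M'.det : X → F) x = (M x).det := fun x => by
    rw [← he x, ← RingHom.map_det]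
    rfl
  have hadj : ∀ x, (M'.adjugate i j : X → F) x = (M x).adjugate i j := fun x => by
    rw [← he x, ← RingHom.map_adjugate]
    rfl
  have h := A.mul_mem (hA _ M'.det.2 fun x => by rw [hdet]; exact (hu x).ne_zero)
    (M'.adjugate i j).2
  convert h using 1
  funext x
  rw [Pi.mul_apply, hdet, hadj, Matrix.inv_def, Matrix.smul_apply, Ring.inverse_eq_inv',
    smul_eq_mul]

/-! ### Regular functions, invariance and the normal form -/

section Invariants

variable {F : Type*} [Field F] {m n l : ℕ} {d : Fin m → Derivation ℤ F F}
  {T : AlgebraicAction d n l}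

theorem isUnit_pi {X : Type*} {φ : X → F} : IsUnit φ ↔ ∀ x, φ x ≠ 0 := by
  rw [Pi.isUnit_iff]
  exact forall_congr' fun x => isUnit_iff_ne_zero

/-- The value of a differential rational function belongs to any ring of functions that is stable
under differentiation and under inversion, and contains its arguments. -/
theorem eval_mem {R ι X : Type*} [CommRing R] [Algebra R F] (A : Subring (X → F))
    (D : X → Fin m → Derivation ℤ F F) (hC : ∀ c : R, (fun _ => algebraMap R F c) ∈ A)
    (hD : ∀ i, ∀ φ ∈ A, (fun x => D x i (φ x)) ∈ A)
    (hA : ∀ φ ∈ A, (∀ x, φ x ≠ 0) → (fun x => (φ x)⁻¹) ∈ A) {u : X → ι → F}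
    (hu : ∀ j, (fun x => u x j) ∈ A) (f : DiffRat R m ι) (hf : ∀ x, f.DefinedAt (D x) (u x)) :
    (fun x => f.eval (D x) (u x)) ∈ A := by
  simp only [DiffRat.eval, div_eq_mul_inv]
  exact A.mul_mem (diffEval_mem A D hC hD hu _) (hA _ (diffEval_mem A D hC hD hu _) hf)

theorem triple_mem {X : Type*} (A : Subring (X → F)) {h : X → Matrix (Fin n) (Fin n) F}
    {g : X → Matrix (Fin m) (Fin m) F} {v : X → Fin l → F}
    (hh : ∀ i j, (fun x => h x i j) ∈ A) (hg : ∀ i j, (fun x => g x i j) ∈ A)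
    (hv : ∀ i, (fun x => v x i) ∈ A) (a : TripleIndex n m l) :
    (fun x => triple (h x) (g x) (v x) a) ∈ A := by
  rcases a with a | a | a
  · exact hh _ _
  · exact hg _ _
  · exact hv _

/-- A ring of functions that is stable under a family of derivations is stable under the
twisted family. -/
theorem twist_apply_mem {X : Type*} (A : Subring (X → F)) (D : X → Fin m → Derivation ℤ F F)
    (hD : ∀ i, ∀ φ ∈ A, (fun x => D x i (φ x)) ∈ A) {g : X → Matrix (Fin m) (Fin m) F}
    (hg : ∀ i j, (fun x => (g x)⁻¹ i j) ∈ A) (i : Fin m) (φ : X → F) (hφ : φ ∈ A) :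
    (fun x => twist (g x) (D x) i (φ x)) ∈ A := by
  simp only [twist_apply]
  have : (fun x => ∑ j, (g x)⁻¹ i j * D x j (φ x)) =
      ∑ j, (fun x => (g x)⁻¹ i j) * (fun x => D x j (φ x)) := by
    funext x
    simp
  rw [this]
  exact A.sum_mem fun j _ => A.mul_mem (hg i j) (hD j φ hφ)

/-- The ring of quotients of `δ`-differential polynomial functions on `W` over `F` with nowhere
vanishing denominators. -/
def regularFunctions (δ : Fin m → Derivation ℤ F F) (W : Set (Fin l → F)) : Subring (W → F) :=
  fracSubring (RingHom.pi fun v : W =>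
    ((diffEval δ v.1 : DiffPoly F m (Fin l) →ₐ[F] F) : DiffPoly F m (Fin l) →+* F))

section Regular

variable {δ : Fin m → Derivation ℤ F F} {W : Set (Fin l → F)}

theorem const_mem_regularFunctions (a : F) : (fun _ => a) ∈ regularFunctions δ W := by
  have h : (fun v : W => diffEval δ v.1 (MvPolynomial.C a : DiffPoly F m (Fin l))) ∈
      regularFunctions δ W := map_mem_fracSubring _
  simpa only [diffEval_C, Algebra.algebraMap_self, RingHom.id_apply] using h

theorem coord_mem_regularFunctions (i : Fin l) :
    (fun v : W => v.1 i) ∈ regularFunctions δ W := by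
  have h : (fun v : W => diffEval δ v.1 (MvPolynomial.X (i, 0) : DiffPoly F m (Fin l))) ∈
      regularFunctions δ W := map_mem_fracSubring _
  simpa only [diffEval_X, iterD_zero] using h

theorem inv_mem_fracSubring_pi {B X : Type*} [CommRing B] {θ : B →+* (X → F)} (φ : X → F)
    (hφ : φ ∈ fracSubring θ) (h0 : ∀ x, φ x ≠ 0) : (fun x => (φ x)⁻¹) ∈ fracSubring θ :=
  mem_fracSubring_of_mul_eq_one hφ (by
    funext x
    simp [h0 x])

theorem inv_mem_regularFunctions (φ : W → F) (hφ : φ ∈ regularFunctions δ W)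
    (h0 : ∀ x, φ x ≠ 0) : (fun x => (φ x)⁻¹) ∈ regularFunctions δ W :=
  inv_mem_fracSubring_pi φ hφ h0

theorem derivation_mem_regularFunctions (hδ : Commuting δ) (i : Fin m) (φ : W → F)
    (hφ : φ ∈ regularFunctions δ W) : (fun v => δ i (φ v)) ∈ regularFunctions δ W := by
  refine derivation_mem_fracSubring (piDerivation fun _ => δ i) (fun p => ?_) hφ
  obtain ⟨p', hp'⟩ := exists_diffEval_eq_derivation (ι := Fin l) hδ i p
  exact ⟨p', funext fun v => hp' v.1⟩

/-- The numerator vanishes on `W₀`, hence on `W` by density, and the denominator is nowhere zero. -/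
theorem eq_zero_of_mem_regularFunctions {W₀ : Set (Fin l → F)}
    (hW : W ⊆ @closure _ (kolchinTopology δ) W₀) (hW₀ : W₀ ⊆ W) {φ : W → F}
    (hφ : φ ∈ regularFunctions δ W) (h : ∀ v : W, v.1 ∈ W₀ → φ v = 0) (v : W) : φ v = 0 := by
  obtain ⟨p, q, hq, hpq⟩ := hφ
  rw [isUnit_pi] at hq
  have hp := diffEval_eq_zero_of_dense hW p (fun v hv => by
    have := congrFun hpq ⟨v, hW₀ hv⟩
    rw [Pi.mul_apply, h _ hv, mul_zero] at this
    exact this.symm) v.1 v.2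
  have h1 := congrFun hpq v
  exact (mul_eq_zero.1 (h1.trans hp)).resolve_left (hq v)

end Regular

/-- The entries of the fixed `h` and `g` enter as coefficients and need not be constants, which is
why `regularFunctions` allows coefficients in `F`. -/
theorem AlgebraicAction.act_mem_regularFunctions (T : AlgebraicAction d n l) (hd : Commuting d)
    {δ : Fin m → Derivation ℤ F F} (hδ : δ ∈ base d) {h : Matrix (Fin n) (Fin n) F}
    {g : Matrix (Fin m) (Fin m) F} (hh : IsUnit h.det) (hg : MemGL δ g) (i : Fin l) :
    (fun v : T.W δ => act T.τ δ h g v.1 i) ∈ regularFunctions δ (T.W δ) := by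
  have hC : ∀ c : constants d, (fun _ => algebraMap (constants d) F c) ∈
      regularFunctions δ (T.W δ) := fun c => const_mem_regularFunctions _
  have hD := derivation_mem_regularFunctions (W := T.W δ) (hd.of_mem_base hδ)
  have hu := triple_mem (regularFunctions δ (T.W δ)) (h := fun _ => h) (g := fun _ => g)
    (fun a b => const_mem_regularFunctions (h a b)) (fun a b => const_mem_regularFunctions (g a b))
    coord_mem_regularFunctions
  exact eval_mem _ (fun _ => δ) hC hD inv_mem_regularFunctions hu (T.τ i)
    (fun v => T.definedAt_τ δ hδ h g hh hg v.1 v.2 i)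

/-- Invariance can be tested on a dense invariant subset on which the function is defined. -/
theorem EquivariantMap.isInvariant_of_dense (P : EquivariantMap T) (hd : Commuting d)
    (f : DiffRat (constants d) m (Fin l)) (hf : ∀ δ ∈ base d, ∀ v ∈ P.W₀ δ, f.DefinedAt δ v)
    (hinv : ∀ δ ∈ base d, ∀ (h : Matrix (Fin n) (Fin n) F) (g : Matrix (Fin m) (Fin m) F),
      IsUnit h.det → MemGL δ g → ∀ v ∈ P.W₀ δ,
        f.eval (twist g δ) (act T.τ δ h g v) = f.eval δ v) : T.IsInvariant f := by
  intro δ hδ h g hh hg v hv h1 h2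
  have hC : ∀ c : constants d, (fun _ => algebraMap (constants d) F c) ∈
      regularFunctions δ (T.W δ) := fun c => const_mem_regularFunctions _
  have hD := derivation_mem_regularFunctions (W := T.W δ) (hd.of_mem_base hδ)
  have hD' := twist_apply_mem _ (fun _ => δ) hD (g := fun _ => g)
    (fun _ _ => const_mem_regularFunctions _)
  have hu := T.act_mem_regularFunctions hd hδ hh hg
  have hu' := coord_mem_regularFunctions (δ := δ) (W := T.W δ)
  -- The equation is cross-multiplied, because `f` need not be defined on all of `T.W δ`. The
  -- difference of the two products is regular there and vanishes on `W₀`.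
  have hmem := (regularFunctions δ (T.W δ)).sub_mem
    ((regularFunctions δ (T.W δ)).mul_mem (diffEval_mem _ (fun _ => twist g δ) hC hD' hu f.num)
      (diffEval_mem _ (fun _ => δ) hC hD hu' f.den))
    ((regularFunctions δ (T.W δ)).mul_mem (diffEval_mem _ (fun _ => δ) hC hD hu' f.num)
      (diffEval_mem _ (fun _ => twist g δ) hC hD' hu f.den))
  have h0 := eq_zero_of_mem_regularFunctions (P.dense_W₀ δ hδ) (P.subset_W δ hδ) hmem
    (fun v hv => sub_eq_zero.2
      ((div_eq_div_iff (hf _ (twist_mem_base hδ hg) _ (P.act_mem δ hδ h g hh hg v.1 hv))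
        (hf δ hδ v.1 hv)).1 (hinv δ hδ h g hh hg v.1 hv))) ⟨v, hv⟩
  exact (div_eq_div_iff h2 h1).2 (sub_eq_zero.1 h0)

/-- The normal form `τ^δ⟨P^δ⟨v⟩; v⟩`. -/
def EquivariantMap.normalForm (P : EquivariantMap T) (δ : Fin m → Derivation ℤ F F)
    (v : Fin l → F) : Fin l → F :=
  act T.τ δ (evalMatrix P.P₀ δ v) (evalMatrix P.P₁ δ v) v

/-- The frame at the moved point is `(h⁻¹ P₀, g⁻¹ P₁)`, so the composite motion is by `(h h⁻¹ P₀, g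
g⁻¹ P₁) = (P₀, P₁)`. -/
theorem EquivariantMap.normalForm_act (P : EquivariantMap T) {δ : Fin m → Derivation ℤ F F}
    (hδ : δ ∈ base d) {h : Matrix (Fin n) (Fin n) F} {g : Matrix (Fin m) (Fin m) F}
    (hh : IsUnit h.det) (hg : MemGL δ g) {v : Fin l → F} (hv : v ∈ P.W₀ δ) :
    P.normalForm (twist g δ) (act T.τ δ h g v) = P.normalForm δ v := by
  have hδ' := twist_mem_base hδ hg
  have hv' := P.act_mem δ hδ h g hh hg v hv
  have e₀ := P.equivariant_P₀ δ hδ h g hh hg v hv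
  have e₁ := P.equivariant_P₁ δ hδ h g hh hg v hv
  rw [normalForm, T.act_act δ hδ h _ g _ hh (P.isUnit_P₀ _ hδ' _ hv') hg
    (P.memGL_P₁ _ hδ' _ hv') v (P.subset_W δ hδ hv), e₀, e₁,
    Matrix.mul_nonsing_inv_cancel_left _ _ hh, Matrix.mul_nonsing_inv_cancel_left _ _ hg.1]
  rfl

theorem EquivariantMap.act_inv_normalForm (P : EquivariantMap T) {δ : Fin m → Derivation ℤ F F}
    (hδ : δ ∈ base d) {v : Fin l → F} (hv : v ∈ P.W₀ δ) :
    act T.τ (twist (evalMatrix P.P₁ δ v) δ) (evalMatrix P.P₀ δ v)⁻¹ (evalMatrix P.P₁ δ v)⁻¹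
      (P.normalForm δ v) = v := by
  have h₀ := P.isUnit_P₀ δ hδ v hv
  have h₁ := P.memGL_P₁ δ hδ v hv
  rw [normalForm, T.act_act δ hδ _ _ _ _ h₀ (Matrix.isUnit_nonsing_inv_det _ h₀) h₁ h₁.inv v
    (P.subset_W δ hδ hv), Matrix.mul_nonsing_inv _ h₀, Matrix.mul_nonsing_inv _ h₁.1,
    T.act_one δ hδ v (P.subset_W δ hδ hv)]

theorem EquivariantMap.W₀_nonempty (P : EquivariantMap T) {δ : Fin m → Derivation ℤ F F}
    (hδ : δ ∈ base d) : (P.W₀ δ).Nonempty := by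
  by_contra h
  rw [Set.not_nonempty_iff_eq_empty] at h
  obtain ⟨v, hv⟩ := @IsIrreducible.nonempty _ (kolchinTopology δ) _ (T.isIrreducible_W δ hδ)
  have := diffEval_eq_zero_of_dense (P.dense_W₀ δ hδ) (1 : DiffPoly F m (Fin l))
    (fun w hw => by simp [h] at hw) v hv
  simp at this

/-- The components of the normal form are given by differential rational functions with constant
coefficients. -/
theorem EquivariantMap.exists_normalForm_eq_eval (P : EquivariantMap T) (hd : Commuting d)
    (i : Fin l) : ∃ f : DiffRat (constants d) m (Fin l), ∀ δ ∈ base d, ∀ v ∈ P.W₀ δ,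
      f.DefinedAt δ v ∧ f.eval δ v = P.normalForm δ v i := by
  -- Functions on all pairs `(δ, v)` are used, so that one numerator and one denominator serve every
  -- `δ` of the base.
  let X := {x : (Fin m → Derivation ℤ F F) × (Fin l → F) // x.1 ∈ base d ∧ x.2 ∈ P.W₀ x.1}
  let θ : DiffPoly (constants d) m (Fin l) →+* (X → F) := RingHom.pi fun x : X =>
    ((diffEval x.1.1 x.1.2 : DiffPoly (constants d) m (Fin l) →ₐ[constants d] F) :
      DiffPoly (constants d) m (Fin l) →+* F)
  have hC : ∀ c : constants d, (fun _ => algebraMap (constants d) F c) ∈ fracSubring θ := by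
    intro c
    convert map_mem_fracSubring (θ := θ) (MvPolynomial.C c) using 1
    funext x
    exact (diffEval_C (δ := x.1.1) x.1.2 c).symm
  have hX : ∀ j, (fun x : X => x.1.2 j) ∈ fracSubring θ := by
    intro j
    convert map_mem_fracSubring (θ := θ) (MvPolynomial.X (j, 0)) using 1
    funext x
    exact ((diffEval_X (δ := x.1.1) x.1.2 (j, 0)).trans (iterD_zero _)).symm
  have hD : ∀ j, ∀ φ ∈ fracSubring θ, (fun x : X => x.1.1 j (φ x)) ∈ fracSubring θ := by
    intro j φ hφ
    refine derivation_mem_fracSubring (piDerivation fun x : X => x.1.1 j) (fun p => ?_) hφ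
    exact ⟨polyDer _ m _ j p, funext fun x => diffEval_polyDer_of_constants
      (hd.of_mem_base x.2.1) (fun i c => apply_constant x.2.1 i c) j x.1.2 p⟩
  have heval := fun f hf => eval_mem (ι := Fin l) (fracSubring θ) (fun x : X => x.1.1) hC hD
    inv_mem_fracSubring_pi hX f hf
  obtain ⟨p, q, hq, hpq⟩ := eval_mem (fracSubring θ) (fun x : X => x.1.1) hC hD
    inv_mem_fracSubring_pi
    (triple_mem _ (fun a b => heval (P.P₀ a b) fun x => P.definedAt_P₀ _ x.2.1 _ x.2.2 a b)
      (fun a b => heval (P.P₁ a b) fun x => P.definedAt_P₁ _ x.2.1 _ x.2.2 a b) hX) (T.τ i)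
    (fun x => T.definedAt_τ _ x.2.1 _ _ (P.isUnit_P₀ _ x.2.1 _ x.2.2)
      (P.memGL_P₁ _ x.2.1 _ x.2.2) _ (P.subset_W _ x.2.1 x.2.2) i)
  rw [isUnit_pi] at hq
  refine ⟨⟨p, q⟩, fun δ hδ v hv => ⟨hq ⟨(δ, v), hδ, hv⟩, ?_⟩⟩
  have := congrFun hpq ⟨(δ, v), hδ, hv⟩
  exact (div_eq_iff (hq ⟨(δ, v), hδ, hv⟩)).2 (this.symm.trans (mul_comm _ _))

end Invariants

/-! ### The function field -/

section Generic

variable {F : Type*} [Field F] {m n l : ℕ} {d : Fin m → Derivation ℤ F F}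

theorem exists_toField_div {ι : Type*} (V : IrreducibleClosed d ι) (x : FunctionField V) :
    ∃ p q, toField V q ≠ 0 ∧ x = toField V p / toField V q := by
  obtain ⟨a, b, hb, rfl⟩ := IsFractionRing.div_surjective
    (A := DiffPoly (constants d) m ι ⧸ vanishingIdeal V) x
  obtain ⟨p, rfl⟩ := Ideal.Quotient.mk_surjective a
  obtain ⟨q, rfl⟩ := Ideal.Quotient.mk_surjective b
  exact ⟨p, q, (IsLocalization.map_units (FunctionField V) ⟨_, hb⟩).ne_zero, rfl⟩

theorem polyDer_comm {R ι : Type*} [CommRing R] (i j : Fin m) (p : DiffPoly R m ι) :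
    polyDer R m ι i (polyDer R m ι j p) = polyDer R m ι j (polyDer R m ι i p) := by
  have h : ⁅polyDer R m ι i, polyDer R m ι j⁆ = 0 := by
    apply MvPolynomial.derivation_ext
    intro x
    simp only [Derivation.commutator_apply, polyDer, MvPolynomial.mkDerivation_X,
      Derivation.zero_apply]
    rw [add_right_comm, sub_self]
  have := DFunLike.congr_fun h p
  rw [Derivation.commutator_apply] at this
  exact sub_eq_zero.1 this

/-- The commutator is again a derivation. It kills the classes of polynomials, hence their
quotients. -/
theorem commuting_fieldDer {ι : Type*} (hd : Commuting d) (V : IrreducibleClosed d ι) :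
    Commuting (fieldDer hd V) := by
  intro i j x
  have hp : ∀ p, ⁅fieldDer hd V i, fieldDer hd V j⁆ (toField V p) = 0 := by
    intro p
    rw [Derivation.commutator_apply]
    simp only [fieldDer_toField]
    rw [polyDer_comm, sub_self]
  obtain ⟨p, q, -, rfl⟩ := exists_toField_div V x
  rw [← sub_eq_zero, ← Derivation.commutator_apply, Derivation.leibniz_div, hp, hp]
  simp

variable {T : AlgebraicAction d n l}

/-- The map that sends a differential polynomial to its class in `C⟨W_e; d⟩` and to its values
on `W₀`. -/
def EquivariantMap.classValues (P : EquivariantMap T) :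
    DiffPoly (constants d) m (Fin l) →+* FunctionField T.We × (P.W₀ d → F) :=
  (toField T.We).prod (RingHom.pi fun v : P.W₀ d =>
    ((diffEval d v.1 : DiffPoly (constants d) m (Fin l) →ₐ[constants d] F) :
      DiffPoly (constants d) m (Fin l) →+* F))

theorem EquivariantMap.toField_eq_zero_of_dense (P : EquivariantMap T)
    {p : DiffPoly (constants d) m (Fin l)} (hp : ∀ v ∈ P.W₀ d, diffEval d v p = 0) :
    toField T.We p = 0 := by
  rw [toField_eq_zero, mem_vanishingIdeal]
  intro v hv
  have := diffEval_eq_zero_of_dense (P.dense_W₀ d (mem_base_self d))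
    (MvPolynomial.map (algebraMap (constants d) F) p)
    (fun w hw => by rw [diffEval_map, hp w hw]) v hv
  rwa [diffEval_map] at this

/-- The transfer principle from points to the function field: the numerator of the difference
vanishes on the dense set `W₀`, so its class is zero. -/
theorem EquivariantMap.fst_eq_of_snd_eq (P : EquivariantMap T) {k k' : FunctionField T.We}
    {φ φ' : P.W₀ d → F} (h : (k, φ) ∈ fracSubring P.classValues)
    (h' : (k', φ') ∈ fracSubring P.classValues) (e : φ = φ') : k = k' := by
  obtain ⟨p, q, hq, hpq⟩ := sub_mem h h'
  have hp : ∀ v ∈ P.W₀ d, diffEval d v p = 0 := by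
    intro v hv
    have := congrFun (congrArg Prod.snd hpq) ⟨v, hv⟩
    simp only [e, Prod.snd_mul, Prod.snd_sub, sub_self, mul_zero] at this
    exact this.symm
  have h1 : toField T.We q * (k - k') = toField T.We p := congrArg Prod.fst hpq
  rw [P.toField_eq_zero_of_dense hp] at h1
  exact sub_eq_zero.1 ((mul_eq_zero.1 h1).resolve_left (Prod.isUnit_iff.1 hq).1.ne_zero)

theorem EquivariantMap.toField_ne_zero (P : EquivariantMap T)
    {q : DiffPoly (constants d) m (Fin l)} (hq : ∀ v ∈ P.W₀ d, diffEval d v q ≠ 0) :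
    toField T.We q ≠ 0 := by
  obtain ⟨v, hv⟩ := P.W₀_nonempty (mem_base_self d)
  intro h
  rw [toField_eq_zero, mem_vanishingIdeal] at h
  exact hq v hv (h v (P.subset_W d (mem_base_self d) hv))

theorem EquivariantMap.toField_eval_mem (P : EquivariantMap T)
    (f : DiffRat (constants d) m (Fin l)) (hf : ∀ v ∈ P.W₀ d, f.DefinedAt d v) :
    (f.toField T.We, fun v : P.W₀ d => f.eval d v.1) ∈ fracSubring P.classValues := by
  refine ⟨f.num, f.den, Prod.isUnit_iff.2 ⟨?_, isUnit_pi.2 fun v => hf v.1 v.2⟩, ?_⟩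
  · exact (P.toField_ne_zero hf).isUnit
  · refine Prod.ext ?_ (funext fun v => ?_)
    · exact mul_div_cancel₀ _ (P.toField_ne_zero hf)
    · exact mul_div_cancel₀ _ (hf v.1 v.2)

theorem EquivariantMap.derivation_mem (P : EquivariantMap T) (hd : Commuting d) (i : Fin m)
    {k : FunctionField T.We} {φ : P.W₀ d → F} (h : (k, φ) ∈ fracSubring P.classValues) :
    (fieldDer hd T.We i k, fun v => d i (φ v)) ∈ fracSubring P.classValues :=
  derivation_mem_fracSubring
    (prodDerivation (fieldDer hd T.We i) (piDerivation fun _ : P.W₀ d => d i))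
    (fun p => ⟨polyDer _ m _ i p, Prod.ext (fieldDer_toField hd T.We i p).symm
      (funext fun v => diffEval_polyDer hd i v.1 p)⟩) h

theorem EquivariantMap.inv_mem (P : EquivariantMap T) {k : FunctionField T.We} {φ : P.W₀ d → F}
    (h : (k, φ) ∈ fracSubring P.classValues) (hφ : ∀ v, φ v ≠ 0) :
    k ≠ 0 ∧ (k⁻¹, fun v => (φ v)⁻¹) ∈ fracSubring P.classValues := by
  have hk : k ≠ 0 := by
    rintro rfl
    obtain ⟨p, q, hq, hpq⟩ := h
    have h1 := (congrArg Prod.fst hpq).symm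
    simp only [Prod.fst_mul, mul_zero] at h1
    have h2 : ∀ v ∈ P.W₀ d, diffEval d v p ≠ 0 := by
      intro v hv
      have h3 := congrFun (congrArg Prod.snd hpq) ⟨v, hv⟩
      have h4 := isUnit_pi.1 (Prod.isUnit_iff.1 hq).2 ⟨v, hv⟩
      exact fun h5 => mul_ne_zero h4 (hφ ⟨v, hv⟩) (h3.trans h5)
    exact P.toField_ne_zero h2 h1
  refine ⟨hk, mem_fracSubring_of_mul_eq_one h (Prod.ext ?_ (funext fun v => ?_))⟩
  · exact mul_inv_cancel₀ hk
  · exact mul_inv_cancel₀ (hφ v)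

/-- A matrix over `C⟨W_e; d⟩` whose values on `W₀` are invertible is invertible. -/
theorem EquivariantMap.isUnit_det_toField (P : EquivariantMap T) {k : ℕ}
    (M : Matrix (Fin k) (Fin k) (DiffRat (constants d) m (Fin l)))
    (hM : ∀ v ∈ P.W₀ d, ∀ i j, (M i j).DefinedAt d v)
    (hu : ∀ v ∈ P.W₀ d, IsUnit (evalMatrix M d v).det) :
    IsUnit (Matrix.det fun i j => (M i j).toField T.We) := by
  let M' : Matrix (Fin k) (Fin k) (fracSubring P.classValues) :=
    fun i j => ⟨_, P.toField_eval_mem (M i j) fun v hv => hM v hv i j⟩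
  let e := (RingHom.fst (FunctionField T.We) (P.W₀ d → F)).comp (fracSubring P.classValues).subtype
  let e' : P.W₀ d → fracSubring P.classValues →+* F := fun v =>
    ((Pi.evalRingHom _ v).comp (RingHom.snd (FunctionField T.We) (P.W₀ d → F))).comp
      (fracSubring P.classValues).subtype
  have h1 : e M'.det = Matrix.det fun i j => (M i j).toField T.We := RingHom.map_det e M'
  have h2 : ∀ v, e' v M'.det = (evalMatrix M d v.1).det := fun v => RingHom.map_det (e' v) M'
  rw [← h1]
  exact (P.inv_mem M'.det.2 fun v => by
    rw [show (M'.det : FunctionField T.We × (P.W₀ d → F)).2 v = e' v M'.det from rfl, h2]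
    exact (hu v.1 v.2).ne_zero).1.isUnit

/-- Invertibility and the symmetry condition hold at each point of `W₀`, and both transfer to the
function field. -/
theorem EquivariantMap.memGL_genericP₁ (P : EquivariantMap T) (hd : Commuting d) :
    MemGL (fieldDer hd T.We) P.genericP₁ := by
  have hb := mem_base_self d
  refine ⟨P.isUnit_det_toField P.P₁ (P.definedAt_P₁ d hb) fun v hv => (P.memGL_P₁ d hb v hv).1,
    fun i j k => ?_⟩
  have h := fun i j k => P.derivation_mem hd i
    (P.toField_eval_mem (P.P₁ j k) fun v hv => P.definedAt_P₁ d hb v hv j k)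
  exact P.fst_eq_of_snd_eq (h i j k) (h j i k)
    (funext fun v => (P.memGL_P₁ d hb v.1 v.2).2 i j k)

end Generic

/-! ### Generation of the function field -/

section Generation

variable {F : Type*} [Field F] {m n l : ℕ} {d : Fin m → Derivation ℤ F F}
  {T : AlgebraicAction d n l}

theorem subset_diffAdjoin {K : Type*} [Field K] (δ : Fin m → Derivation ℤ K K) (S : Set K) :
    S ⊆ diffAdjoin δ S := fun _ hx => Subfield.mem_sInf.2 fun _ hL => hL.1 hx

theorem derivation_mem_diffAdjoin {K : Type*} [Field K] (δ : Fin m → Derivation ℤ K K) (S : Set K)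
    (i : Fin m) {a : K} (ha : a ∈ diffAdjoin δ S) : δ i a ∈ diffAdjoin δ S :=
  Subfield.mem_sInf.2 fun L hL => hL.2 i a (Subfield.mem_sInf.1 ha L hL)

theorem derivation_mem_of_twist_mem {K : Type*} [Field K] {δ : Fin m → Derivation ℤ K K}
    {g : Matrix (Fin m) (Fin m) K} (hg : IsUnit g.det) (L : Subfield K) (hL : ∀ i j, g i j ∈ L)
    (hδ : ∀ i, ∀ a ∈ L, twist g δ i a ∈ L) (i : Fin m) {a : K} (ha : a ∈ L) : δ i a ∈ L := by
  rw [apply_eq_sum_twist hg]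
  exact L.sum_mem fun j _ => L.mul_mem (hL i j) (hδ j a ha)

/-- A subfield of the function field that contains the constants and the coordinates and is
stable under the derivations is the whole field. -/
theorem eq_top_of_coords_mem {ι : Type*} (hd : Commuting d) (V : IrreducibleClosed d ι)
    (L : Subfield (FunctionField V)) (hC : ∀ c, toField V (MvPolynomial.C c) ∈ L)
    (hX : ∀ i, toField V (MvPolynomial.X (i, 0)) ∈ L)
    (hD : ∀ i, ∀ a ∈ L, fieldDer hd V i a ∈ L) : L = ⊤ := by
  -- Induction on the order of the derivative: a nonzero multi-index is lowered by one in some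
  -- direction `j`.
  have hX' : ∀ (k : ℕ) (i : ι) (α : Fin m → ℕ), ∑ j, α j = k →
      toField V (MvPolynomial.X (i, α)) ∈ L := by
    intro k
    induction k with
    | zero =>
      intro i α hα
      have : α = 0 := by
        funext j
        exact (Finset.sum_eq_zero_iff.1 hα) j (Finset.mem_univ j)
      rw [this]
      exact hX i
    | succ k ih =>
      intro i α hα
      obtain ⟨j, -, hj⟩ : ∃ j ∈ Finset.univ, α j ≠ 0 :=
        Finset.exists_ne_zero_of_sum_ne_zero (by omega)
      have e : α = (α - Pi.single j 1) + Pi.single j 1 := by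
        refine (tsub_add_cancel_of_le ?_).symm
        intro a
        by_cases h : a = j
        · subst h
          simpa using Nat.one_le_iff_ne_zero.2 hj
        · simp [h]
      have hs : ∑ a, (α - Pi.single j 1 : Fin m → ℕ) a = k := by
        have h1 := hα
        rw [e] at h1
        simp only [Pi.add_apply, Finset.sum_add_distrib, Finset.sum_pi_single', Finset.mem_univ,
          if_true] at h1
        exact Nat.succ_injective h1
      have := hD j _ (ih i _ hs)
      rw [fieldDer_toField, polyDer, MvPolynomial.mkDerivation_X] at this
      rw [e]
      exact this
  have hp : ∀ p, toField V p ∈ L := by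
    intro p
    induction p using MvPolynomial.induction_on with
    | C a => exact hC a
    | add p q hp hq => rw [map_add]; exact L.add_mem hp hq
    | mul_X p x hp => rw [map_mul]; exact L.mul_mem hp (hX' _ x.1 x.2 rfl)
  rw [eq_top_iff]
  intro x _
  obtain ⟨p, q, -, rfl⟩ := exists_toField_div V x
  exact L.div_mem (hp p) (hp q)

theorem EquivariantMap.toField_C_mem_invariants (c : constants d) :
    toField T.We (MvPolynomial.C c) ∈ T.invariants := by
  refine ⟨⟨MvPolynomial.C c, 1⟩, fun δ hδ => ?_, ?_, ?_⟩
  · obtain ⟨v, hv⟩ := @IsIrreducible.nonempty _ (kolchinTopology δ) _ (T.isIrreducible_W δ hδ)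
    exact ⟨v, hv, by simp [DiffRat.DefinedAt]⟩
  · intro δ hδ h g _ _ v _ _ _
    simp only [DiffRat.eval, diffEval_C, map_one]
  · simp [DiffRat.toField]

/-- Supplies the invariants from which, together with `P`, the coordinates are rebuilt. -/
theorem EquivariantMap.exists_invariant_eq_normalForm (P : EquivariantMap T) (hd : Commuting d)
    (i : Fin l) : ∃ k ∈ T.invariants,
      (k, fun v : P.W₀ d => P.normalForm d v.1 i) ∈ fracSubring P.classValues := by
  obtain ⟨f, hf⟩ := P.exists_normalForm_eq_eval hd i
  refine ⟨f.toField T.We, ⟨f, fun δ hδ => ?_, ?_, rfl⟩, ?_⟩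
  · obtain ⟨v, hv⟩ := P.W₀_nonempty hδ
    exact ⟨v, P.subset_W δ hδ hv, (hf δ hδ v hv).1⟩
  · refine P.isInvariant_of_dense hd f (fun δ hδ v hv => (hf δ hδ v hv).1) ?_
    intro δ hδ h g hh hg v hv
    rw [(hf _ (twist_mem_base hδ hg) _ (P.act_mem δ hδ h g hh hg v hv)).2, (hf δ hδ v hv).2,
      P.normalForm_act hδ hh hg hv]
  · have := P.toField_eval_mem f fun v hv => (hf d (mem_base_self d) v hv).1
    convert this using 2
    funext v
    exact (hf d (mem_base_self d) v.1 v.2).2.symm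

theorem EquivariantMap.diffAdjoin_eq_top (P : EquivariantMap T) (hd : Commuting d) :
    diffAdjoin (P.delta hd) (T.invariants ∪ P.components) = ⊤ := by
  set L := diffAdjoin (P.delta hd) (T.invariants ∪ P.components) with hLdef
  have hb := mem_base_self d
  have hsub : T.invariants ∪ P.components ⊆ L := subset_diffAdjoin _ _
  have hP₀ : ∀ i j, P.genericP₀ i j ∈ L := fun i j => hsub (Or.inr (Or.inl ⟨i, j, rfl⟩))
  have hP₁ : ∀ i j, P.genericP₁ i j ∈ L := fun i j => hsub (Or.inr (Or.inr ⟨i, j, rfl⟩))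
  have hLd : ∀ i, ∀ a ∈ L, fieldDer hd T.We i a ∈ L := fun i a ha =>
    derivation_mem_of_twist_mem (P.memGL_genericP₁ hd).1 L hP₁
      (fun i a ha => derivation_mem_diffAdjoin (P.delta hd) _ i ha) i ha
  refine eq_top_of_coords_mem hd T.We L
    (fun c => hsub (Or.inl (toField_C_mem_invariants c))) (fun i => ?_) hLd
  -- The functions on `W₀` that are the values of some element of `L`. It suffices to show that the
  -- coordinate function `v ↦ v i` lies in `A` and then to transfer.
  let A : Subring (P.W₀ d → F) := (fracSubring P.classValues ⊓
    L.toSubring.comap (RingHom.fst _ _)).map (RingHom.snd (FunctionField T.We) (P.W₀ d → F))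
  have hA : ∀ {φ}, φ ∈ A ↔ ∃ k ∈ L, (k, φ) ∈ fracSubring P.classValues := by
    intro φ
    constructor
    · rintro ⟨⟨k, φ⟩, ⟨h1, h2⟩, rfl⟩
      exact ⟨k, h2, h1⟩
    · rintro ⟨k, h1, h2⟩
      exact ⟨(k, φ), ⟨h2, h1⟩, rfl⟩
  have hinv : ∀ φ ∈ A, (∀ x, φ x ≠ 0) → (fun x => (φ x)⁻¹) ∈ A := by
    intro φ hφ h0
    obtain ⟨k, hk, h⟩ := hA.1 hφ
    exact hA.2 ⟨k⁻¹, L.inv_mem hk, (P.inv_mem h h0).2⟩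
  have hC : ∀ c : constants d, (fun _ => algebraMap (constants d) F c) ∈ A := fun c =>
    hA.2 ⟨_, hsub (Or.inl (toField_C_mem_invariants c)), by
      convert map_mem_fracSubring (θ := P.classValues) (MvPolynomial.C c) using 1
      exact Prod.ext rfl (funext fun v => (diffEval_C (δ := d) v.1 c).symm)⟩
  have hD : ∀ j, ∀ φ ∈ A, (fun x => d j (φ x)) ∈ A := by
    intro j φ hφ
    obtain ⟨k, hk, h⟩ := hA.1 hφ
    exact hA.2 ⟨_, hLd j k hk, P.derivation_mem hd j h⟩
  have hM₀ : ∀ a b, (fun v : P.W₀ d => evalMatrix P.P₀ d v.1 a b) ∈ A := fun a b =>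
    hA.2 ⟨_, hP₀ a b, P.toField_eval_mem _ fun v hv => P.definedAt_P₀ d hb v hv a b⟩
  have hM₁ : ∀ a b, (fun v : P.W₀ d => evalMatrix P.P₁ d v.1 a b) ∈ A := fun a b =>
    hA.2 ⟨_, hP₁ a b, P.toField_eval_mem _ fun v hv => P.definedAt_P₁ d hb v hv a b⟩
  have hN₀ := inv_apply_mem A hinv hM₀ fun v => P.isUnit_P₀ d hb v.1 v.2
  have hN₁ := inv_apply_mem A hinv hM₁ fun v => (P.memGL_P₁ d hb v.1 v.2).1
  have hw : ∀ a, (fun v : P.W₀ d => P.normalForm d v.1 a) ∈ A := by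
    intro a
    obtain ⟨k, hk, h⟩ := P.exists_invariant_eq_normalForm hd a
    exact hA.2 ⟨k, hsub (Or.inl hk), h⟩
  -- The inverse frame applied to the normal form. The operators `twist (evalMatrix P.P₁ d v.1) d`
  -- vary with the point `v`, yet preserve `A` because the entries of `P₁⁻¹` lie in `A`.
  have hx := eval_mem A (fun v : P.W₀ d => twist (evalMatrix P.P₁ d v.1) d) hC
    (twist_apply_mem A (fun _ => d) hD hN₁) hinv (triple_mem A hN₀ hN₁ hw) (T.τ i)
    (fun v => by
      have h₀ := P.isUnit_P₀ d hb v.1 v.2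
      have h₁ := P.memGL_P₁ d hb v.1 v.2
      exact T.definedAt_τ _ (twist_mem_base hb h₁) _ _ (Matrix.isUnit_nonsing_inv_det _ h₀)
        h₁.inv _ (T.act_mem d hb _ _ h₀ h₁ v.1 (P.subset_W d hb v.2)) i)
  obtain ⟨k, hk, h⟩ := hA.1 hx
  -- On `W₀` this expression equals the coordinate `v i`, so the element `k` of `L` is the class of
  -- the `i`-th coordinate.
  have hX : toField T.We (MvPolynomial.X (i, 0)) = k := by
    refine P.fst_eq_of_snd_eq (map_mem_fracSubring (MvPolynomial.X (i, 0))) h (funext fun v => ?_)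
    exact ((diffEval_X (δ := d) v.1 (i, 0)).trans (iterD_zero _)).trans
      (congrFun (P.act_inv_normalForm hb v.2) i).symm
  rw [hX]
  exact hk

end Generation

end DiffInv

end

theorem corollary2p5 {F : Type*} [Field F] [CharZero F] {m n l : ℕ}
    (d : Fin m → Derivation ℤ F F) (hcomm : DiffInv.Commuting d)
    (hindep : LinearIndependent F d) (hclosed : DiffInv.IsDifferentiallyClosed d)
    (T : DiffInv.AlgebraicAction d n l) (P : DiffInv.EquivariantMap T) :
    IsUnit P.genericP₀.det ∧ IsUnit P.genericP₁.det ∧ DiffInv.Commuting (P.delta hcomm) ∧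
      DiffInv.diffAdjoin (P.delta hcomm) (T.invariants ∪ P.components) = ⊤ :=
  ⟨P.isUnit_det_toField P.P₀ (P.definedAt_P₀ d (DiffInv.mem_base_self d))
      (P.isUnit_P₀ d (DiffInv.mem_base_self d)),
    (P.memGL_genericP₁ hcomm).1,
    DiffInv.commuting_twist (DiffInv.commuting_fieldDer hcomm T.We) (P.memGL_genericP₁ hcomm),
    P.diffAdjoin_eq_top hcomm⟩
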